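/- A combinatorial map $\mathcal M=\mathcal M(F;t,r,\ell)$ consists of a finite set $F$ of flags and three fixed-point-free involutory permutations $t,r,\ell$ of $F$ such that $t\ell=\ell t$ and $\langle t,r,\ell\rangle$ is transitive on $F$. Its vertices are the orbits of $\langle t,r\rangle$ on $F$; its automorphism group $\mathrm{Aut}(\mathcal M)$ is the centralizer of $\langle t,r,\ell\rangle$ in the symmetric group on $F$; and $\mathcal M$ is regular if $\mathrm{Aut}(\mathcal M)$ acts regularly on $F$. Let $p$ be a prime, let $k\ge 2$, and let $\mathcal M$ be a regular map with exactly $p^k$ vertices that is normal, i.e. a Sylow $p$-subgroup $P$ of $G=\mathrm{Aut}(\mathcal M)$ is normal in $G$. Suppose that $G$ acts primitively on the set of vertices. Let $H$ be the stabilizer in $G$ of a vertex, let $H_G=\bigcap_{g\in G}H^g$ be its core, and put $P_0=P\cap H_G$. Then $k$ is even, and at least one of the following holds: 1. $P=P_0\times T$ (internal direct product) for some subgroup $T\cong\mathbb Z_p^k$; 2. $P=\Omega_1(P)\ast P_0$ (internal central product: $P=\Omega_1(P)P_0$, $[\Omega_1(P),P_0]=1$, and $\Omega_1(P)\cap P_0$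 is central in $P$), where $P_0=Z(P)$ and $\Omega_1(P)=\langle x\in P\mid x^p=1\rangle$ is equal to $\{x\in P\mid x^p=1\}$ and is an extraspecial $p$-group, i.e. a finite $p$-group $E$ with $\Phi(E)=E'=Z(E)$ of order $p$. -/

import Mathlib

/-- A combinatorial map on a flag set `F`: three fixed-point-free involutory permutations
`t, r, l` (transversal, rotary and longitudinal involution) of `F` such that `t` and `l` commute
and the group generated by `t, r, l` is transitive on `F`. -/
structure CombinatorialMap (F : Type*) where
  t : Equiv.Perm F
  r : Equiv.Perm F
  l : Equiv.Perm F
  t_involutive : Function.Involutive t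
  r_involutive : Function.Involutive r
  l_involutive : Function.Involutive l
  t_ne : ∀ x, t x ≠ x
  r_ne : ∀ x, r x ≠ x
  l_ne : ∀ x, l x ≠ x
  t_l_comm : t * l = l * t
  transitive : ∀ x y : F, ∃ g ∈ Subgroup.closure ({t, r, l} : Set (Equiv.Perm F)), g x = y

namespace CombinatorialMap

variable {F : Type*} (M : CombinatorialMap F)

/-- The monodromy group, generated by the three involutions. -/
def monodromy : Subgroup (Equiv.Perm F) :=
  Subgroup.closure {M.t, M.r, M.l}

/-- The automorphism group: the permutations of the flags that commute with `t`, `r` and `l`,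
that is, the centralizer of the monodromy group in the symmetric group on the flags. -/
def aut : Subgroup (Equiv.Perm F) :=
  Subgroup.centralizer (M.monodromy : Set (Equiv.Perm F))

/-- The subgroup of the monodromy group whose orbits are the vertices. -/
def vertexGroup : Subgroup (Equiv.Perm F) :=
  Subgroup.closure {M.t, M.r}

/-- The vertices of the map: the orbits of `⟨t, r⟩` on the flags. -/
def Vertex : Type _ :=
  MulAction.orbitRel.Quotient M.vertexGroup F

/-- The vertex that contains a given flag. -/
def vertexOf (x : F) : M.Vertex :=
  Quotient.mk (MulAction.orbitRel M.vertexGroup F) x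

theorem vertexGroup_le_monodromy : M.vertexGroup ≤ M.monodromy := by
  apply Subgroup.closure_mono
  intro g hg
  simp only [Set.mem_insert_iff, Set.mem_singleton_iff] at hg ⊢
  tauto

theorem aut_apply_comm (g : M.aut) {h : Equiv.Perm F} (hh : h ∈ M.monodromy) (x : F) :
    (g : Equiv.Perm F) (h x) = h ((g : Equiv.Perm F) x) := by
  have := Subgroup.mem_centralizer_iff.mp g.2 h hh
  exact (congrArg (fun k : Equiv.Perm F => k x) this).symm

/-- Automorphisms permute the vertices, through their action on the flags. -/
instance : MulAction M.aut M.Vertex where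
  smul g := Quotient.map' (s₁ := MulAction.orbitRel M.vertexGroup F)
    (s₂ := MulAction.orbitRel M.vertexGroup F) (fun x => (g : Equiv.Perm F) x) (by
      rintro x y ⟨h, rfl⟩
      exact ⟨h, (M.aut_apply_comm g (M.vertexGroup_le_monodromy h.2) y).symm⟩)
  one_smul v := by
    induction v using Quotient.inductionOn'
    rfl
  mul_smul g h v := by
    induction v using Quotient.inductionOn'
    rfl

theorem smul_vertexOf (g : M.aut) (x : F) :
    g • M.vertexOf x = M.vertexOf ((g : Equiv.Perm F) x) := rfl

/-- A map is regular if its automorphism group acts regularly on the flags. -/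
def IsRegular : Prop :=
  ∀ x y : F, ∃! g : M.aut, (g : Equiv.Perm F) x = y

/-- A (regular) map with a power of `p` vertices is normal if its automorphism group has a normal
Sylow `p`-subgroup. -/
def IsNormalAt (p : ℕ) : Prop :=
  ∃ P : Sylow p M.aut, (P : Subgroup M.aut).Normal

end CombinatorialMap

/-- `P` is the internal direct product of its subgroups `A` and `B`. -/
def IsInternalDirectProduct {G : Type*} [Group G] (P A B : Subgroup G) : Prop :=
  A ⊔ B = P ∧ A ⊓ B = ⊥ ∧ ∀ a ∈ A, ∀ b ∈ B, a * b = b * a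

/-- `P` is the (internal) central product `A ∗ B` of its subgroups `A` and `B`: `P = A B`, the
elements of `A` commute with those of `B`, and `A ∩ B` is a central subgroup of `P`. -/
def IsCentralProduct {G : Type*} [Group G] (P A B : Subgroup G) : Prop :=
  A ⊔ B = P ∧ (∀ a ∈ A, ∀ b ∈ B, a * b = b * a) ∧
    A ⊓ B ≤ Subgroup.centralizer (P : Set G)

/-- `Ω₁(P)`: the subgroup generated by the elements `x` of `P` with `x ^ p = 1`. -/
def Omega1 {G : Type*} [Group G] (p : ℕ) (P : Subgroup G) : Subgroup G :=
  Subgroup.closure {x : G | x ∈ P ∧ x ^ p = 1}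

/-- Extraspecial `p`-groups: finite `p`-groups `E` with `Φ(E) = E' = Z(E)` of order `p`. -/
def IsExtraspecial (p : ℕ) (E : Type*) [Group E] : Prop :=
  Finite E ∧ IsPGroup p E ∧ Nat.card (Subgroup.center E) = p ∧
    commutator E = Subgroup.center E ∧ frattini E = Subgroup.center E

/-! ### Power formula and groups of exponent `p` -/

open Subgroup
open scoped commutatorElement

/-! Regularity makes `G` a group generated by three involutions `a`, `b`, `c`, with vertex
stabilizer `H = ⟨a, b⟩` dihedral; primitivity makes `H` maximal. If `p = 2`, then `G` is a 2-group,
whose maximal subgroups have index 2, against `k ≥ 2`. So `p` is odd, `P ∩ H` consists of rotations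
and is cyclic, and since normalizers grow in `P` it is normal in `G`; hence it equals `P₀`.
Maximality of `H` then makes `P / P₀` a chief factor of order `p ^ k`. This is
`isCyclicByChief_of_involutions`, and the rest uses only that data.

Structure of `P`: the chief factor is elementary abelian. It cannot embed in `Aut(P₀)`, which is
cyclic for odd `p`, so `P₀` is central (`base_le_centralizer`). Thus `P` has class at most 2 with
commutators of order dividing `p`, and `x ↦ x ^ p` is a homomorphism from `P` to `P₀`. Its kernel is
`Ω₁(P)`, and counting gives `P = Ω₁(P) P₀`. An abelian `P` yields the direct product, a nonabelian
one the central product.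

Parity of `k`: `P` acts trivially on `P / P₀`, so the two involutions `a`, `b` act irreducibly on
it. A noncyclic group with such an action has square order (`isSquare_card_or_isCyclic`). -/

/-- Carrying one `x` leftwards past `y ^ m` costs `m` commutators, and `0 + 1 + ... + (n - 1)` is
the binomial coefficient. -/
theorem mul_pow_of_commute_commutatorElement {G : Type*} [Group G] {x y : G}
    (hx : Commute ⁅y, x⁆ x) (hy : Commute ⁅y, x⁆ y) (n : ℕ) :
    (x * y) ^ n = x ^ n * y ^ n * ⁅y, x⁆ ^ n.choose 2 := by
  set c := ⁅y, x⁆ with hc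
  have hyx : y * x = c * (x * y) := by rw [hc, commutatorElement_def]; group
  have hynx : ∀ m : ℕ, y ^ m * x = x * y ^ m * c ^ m := by
    intro m
    induction m with
    | zero => simp
    | succ m ih =>
      have h1 : Commute c (x * y ^ m * y) := (hx.mul_right (hy.pow_right m)).mul_right hy
      calc y ^ (m + 1) * x = y ^ m * (y * x) := by rw [pow_succ, mul_assoc]
        _ = y ^ m * x * y * c := by rw [hyx, (hx.mul_right hy).eq]; group
        _ = x * y ^ m * (c ^ m * y) * c := by rw [ih]; group
        _ = x * y ^ (m + 1) * c ^ (m + 1) := by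
          rw [(hy.pow_left m).eq]; group
  induction n with
  | zero => simp
  | succ n ih =>
    have hxy : Commute c (x * y) := hx.mul_right hy
    calc (x * y) ^ (n + 1) = x ^ n * y ^ n * (c ^ n.choose 2 * (x * y)) := by
          rw [pow_succ, ih, mul_assoc]
      _ = x ^ n * (y ^ n * x) * y * c ^ n.choose 2 := by
          rw [(hxy.pow_left _).eq]; group
      _ = x ^ n * x * y ^ n * (c ^ n * y) * c ^ n.choose 2 := by rw [hynx]; group
      _ = x ^ (n + 1) * y ^ (n + 1) * c ^ (n + 1).choose 2 := by
          rw [(hy.pow_left n).eq, Nat.choose_succ_succ' n 1, Nat.choose_one_right, pow_add c]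
          group

theorem mem_zpowers_zpow_of_pow_eq_one {G : Type*} [Group G] {p : ℕ} (hp : p.Prime) {y : G}
    (hy : y ^ p = 1) {i : ℤ} (hi : y ^ i ≠ 1) : y ∈ zpowers (y ^ i) := by
  have hco : IsCoprime i (p : ℤ) := by
    refine ((Nat.prime_iff_prime_int.mp hp).coprime_iff_not_dvd.mpr fun h => ?_).symm
    obtain ⟨j, rfl⟩ := h
    exact absurd (by rw [zpow_mul, zpow_natCast, hy, one_zpow]) hi
  obtain ⟨u, w, huw⟩ := hco
  refine mem_zpowers_iff.mpr ⟨u, ?_⟩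
  rw [← zpow_mul, mul_comm]
  calc y ^ (u * i) = y ^ (u * i + w * p) := by
        rw [zpow_add, mul_comm w, zpow_mul y (p : ℤ), zpow_natCast, hy, one_zpow, mul_one]
    _ = y := by rw [huw, zpow_one]

/-- In a finite group of exponent `p`, a subgroup `N` containing the derived subgroup lies in a
maximal subgroup avoiding a given element outside `N`. -/
theorem exists_le_isCoatom_notMem {E : Type*} [Group E] [Finite E] {p : ℕ} (hp : p.Prime)
    (hexp : ∀ x : E, x ^ p = 1) {N : Subgroup E} (hN : commutator E ≤ N) {x : E} (hx : x ∉ N) :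
    ∃ M : Subgroup E, N ≤ M ∧ x ∉ M ∧ M ⊔ zpowers x = ⊤ ∧ IsCoatom M := by
  obtain ⟨M, hNM, hM⟩ := Set.Finite.exists_le_maximal
    (Set.toFinite {M : Subgroup E | N ≤ M ∧ x ∉ M}) (a := N) ⟨le_rfl, hx⟩
  have : M.Normal := Subgroup.Normal.of_commutator_le E (hN.trans hNM)
  -- An exchange property: maximality of `M` gives `x = m * y ^ i` with `y ^ i ≠ 1`, and exponent
  -- `p` recovers `y` from `y ^ i`.
  have key : ∀ y ∉ M, x ∈ M ⊔ zpowers y ∧ y ∈ M ⊔ zpowers x := by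
    intro y hy
    have hxy : x ∈ M ⊔ zpowers y := by
      by_contra h
      exact hy (hM.2 ⟨hNM.trans le_sup_left, h⟩ le_sup_left
        (mem_sup_right (mem_zpowers y)))
    refine ⟨hxy, ?_⟩
    obtain ⟨m, hm, z, hz, hmz⟩ := mem_sup_of_normal_left.mp hxy
    obtain ⟨i, rfl⟩ := mem_zpowers_iff.mp hz
    have hi : y ^ i ≠ 1 := fun h => hM.1.2 (by rw [← hmz, h, mul_one]; exact hm)
    have hyi : y ^ i ∈ M ⊔ zpowers x := by
      rw [eq_inv_mul_of_mul_eq hmz]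
      exact mul_mem (mem_sup_left (inv_mem hm)) (mem_sup_right (mem_zpowers x))
    exact (zpowers_le.mpr hyi) (mem_zpowers_zpow_of_pow_eq_one hp (hexp y) hi)
  have htop : M ⊔ zpowers x = ⊤ := by
    refine eq_top_iff.mpr fun y _ => ?_
    by_cases hy : y ∈ M
    · exact mem_sup_left hy
    · exact (key y hy).2
  refine ⟨M, hNM, hM.1.2, htop, fun h => hM.1.2 (h ▸ mem_top x), fun L hL => ?_⟩
  obtain ⟨y, hyL, hyM⟩ := SetLike.exists_of_lt hL
  have hxL : x ∈ L := (sup_le hL.le (zpowers_le.mpr hyL)) (key y hyM).1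
  exact top_le_iff.mp (htop ▸ sup_le hL.le (zpowers_le.mpr hxL))

/-- Every element outside the derived subgroup is avoided by some maximal subgroup. Conversely,
maximal subgroups of a nilpotent group are normal with cyclic quotient, so they contain the derived
subgroup. -/
theorem frattini_eq_commutator_of_exponent {E : Type*} [Group E] [Finite E] {p : ℕ}
    (hp : p.Prime) (hexp : ∀ x : E, x ^ p = 1) : frattini E = commutator E := by
  have : Fact p.Prime := ⟨hp⟩
  have hE : IsPGroup p E := fun x => ⟨1, by rw [pow_one, hexp]⟩
  have := hE.isNilpotent
  refine le_antisymm (fun x hx => ?_) ?_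
  · by_contra hxN
    obtain ⟨M, -, hxM, -, hM⟩ := exists_le_isCoatom_notMem hp hexp le_rfl hxN
    exact hxM (frattini_le_coatom hM hx)
  · refine le_iInf₂ fun M hM => ?_
    have hMn : M.Normal :=
      NormalizerCondition.normal_of_coatom M Group.normalizerCondition_of_isNilpotent hM
    obtain ⟨x, -, hxM⟩ := SetLike.exists_of_lt hM.lt_top
    have htop : M ⊔ zpowers x = ⊤ :=
      hM.2 _ (left_lt_sup.mpr fun h => hxM (h (mem_zpowers x)))
    exact hMn.commutator_le_of_self_sup_commutative_eq_top htop inferInstance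

theorem nonempty_addEquiv_pi_zmod {V : Type*} [AddCommGroup V] [Finite V] {p k : ℕ}
    [Fact p.Prime] [Module (ZMod p) V] (hcard : Nat.card V = p ^ k) :
    Nonempty (V ≃+ (Fin k → ZMod p)) := by
  have e := (Module.finBasis (ZMod p) V).equivFun.toAddEquiv
  have h1 := Nat.card_congr e.toEquiv
  rw [Nat.card_fun, Nat.card_zmod, Nat.card_fin, hcard] at h1
  rw [Nat.pow_right_injective (Fact.out : p.Prime).two_le h1]
  exact ⟨e⟩

theorem nonempty_mulEquiv_pi_zmod {T : Type*} [Group T] [Finite T] {p k : ℕ} (hp : p.Prime)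
    (hcomm : ∀ x y : T, x * y = y * x) (hexp : ∀ x : T, x ^ p = 1)
    (hcard : Nat.card T = p ^ k) : Nonempty (T ≃* Multiplicative (Fin k → ZMod p)) := by
  let _ : CommGroup T := { ‹Group T› with mul_comm := hcomm }
  have : Fact p.Prime := ⟨hp⟩
  have : Module (ZMod p) (Additive T) := AddCommGroup.zmodModule fun x => hexp x.toMul
  obtain ⟨e⟩ := nonempty_addEquiv_pi_zmod (p := p) (V := Additive T) hcard
  exact ⟨AddEquiv.toMultiplicativeRight e⟩

theorem card_le_of_le_isCyclic {G : Type*} [Group G] [Finite G] {p : ℕ} (hp : 0 < p)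
    {A C : Subgroup G} [IsCyclic C] (hAC : A ≤ C) (hA : ∀ x ∈ A, x ^ p = 1) :
    Nat.card A ≤ p := by
  have : IsCyclic A := isCyclic_of_injective (inclusion hAC) (inclusion_injective hAC)
  rw [← IsCyclic.exponent_eq_card]
  exact Nat.le_of_dvd hp (Monoid.exponent_dvd_of_forall_pow_eq_one fun x => Subtype.ext (hA x x.2))

/-- A normal `p`-subgroup `P` of `G`, for an odd prime `p`, with a cyclic subgroup `P₀` normal in
`G` such that `P / P₀` is a chief factor of `G` of order `p ^ k`, `k ≥ 2`. -/
structure IsCyclicByChief {G : Type*} [Group G] (p k : ℕ) (P P₀ : Subgroup G) : Prop where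
  prime : p.Prime
  ne_two : p ≠ 2
  two_le : 2 ≤ k
  isPGroup : IsPGroup p P
  normal : P.Normal
  normal₀ : P₀.Normal
  le : P₀ ≤ P
  isCyclic : IsCyclic P₀
  relIndex : P₀.relIndex P = p ^ k
  chief : ∀ K : Subgroup G, K.Normal → P₀ ≤ K → K ≤ P → K = P₀ ∨ K = P

/-! ### Centrality of `P₀` and the power map -/

namespace IsCyclicByChief

variable {G : Type*} [Group G] {p k : ℕ} {P P₀ : Subgroup G}

theorem ne (h : IsCyclicByChief p k P P₀) : P₀ ≠ P := by
  rintro rfl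
  have h1 := h.relIndex
  rw [relIndex_self] at h1
  exact (Nat.one_lt_pow (by have := h.two_le; omega) h.prime.one_lt).ne h1

/-- Otherwise chiefness forces `P' P₀ = P`, and `P / P₀` would be a nontrivial perfect `p`-group. -/
theorem commutator_le [Finite G] (h : IsCyclicByChief p k P P₀) : ⁅P, P⁆ ≤ P₀ := by
  have := h.normal
  have := h.normal₀
  have : Fact p.Prime := ⟨h.prime⟩
  rcases h.chief (⁅P, P⁆ ⊔ P₀) inferInstance le_sup_right
    (sup_le (commutator_le_self P) h.le) with h1 | h1
  · exact h1 ▸ le_sup_left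
  · exfalso
    have hPQ : IsPGroup p (P.map (QuotientGroup.mk' P₀)) := h.isPGroup.map _
    have hnil := hPQ.isNilpotent
    have hQ : ⁅P.map (QuotientGroup.mk' P₀), P.map (QuotientGroup.mk' P₀)⁆ =
        P.map (QuotientGroup.mk' P₀) := by
      rw [← map_commutator]
      conv_rhs => rw [← h1]
      rw [Subgroup.map_sup, QuotientGroup.map_mk'_self, sup_bot_eq]
    have hnt : Nontrivial (P.map (QuotientGroup.mk' P₀)) := by
      rw [nontrivial_iff_ne_bot]
      intro h2
      rw [Subgroup.map_eq_bot_iff, QuotientGroup.ker_mk'] at h2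
      exact h.ne (le_antisymm h.le h2)
    refine (Group.IsSolvable.commutator_lt_top_of_nontrivial
      (P.map (QuotientGroup.mk' P₀))).ne ?_
    apply map_injective (P.map (QuotientGroup.mk' P₀)).subtype_injective
    rw [map_subtype_commutator, hQ, ← MonoidHom.range_eq_map, range_subtype]

theorem commutatorElement_mem [Finite G] (h : IsCyclicByChief p k P P₀) {x y : G} (hx : x ∈ P)
    (hy : y ∈ P) : ⁅x, y⁆ ∈ P₀ :=
  h.commutator_le (commutator_mem_commutator hx hy)

theorem exists_pow_mem (h : IsCyclicByChief p k P P₀) : ∃ x ∈ P, x ∉ P₀ ∧ x ^ p ∈ P₀ := by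
  have := h.normal₀
  have : Fact p.Prime := ⟨h.prime⟩
  have hcard : p ∣ Nat.card (P ⧸ P₀.subgroupOf P) := by
    change p ∣ P₀.relIndex P
    rw [h.relIndex]
    exact dvd_pow_self p (by have := h.two_le; omega)
  have : Finite (P ⧸ P₀.subgroupOf P) := Nat.finite_of_card_ne_zero <| by
    change P₀.relIndex P ≠ 0
    rw [h.relIndex]
    exact pow_ne_zero _ h.prime.ne_zero
  obtain ⟨q, hq⟩ := exists_prime_orderOf_dvd_card' p hcard
  obtain ⟨x, rfl⟩ := QuotientGroup.mk_surjective q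
  refine ⟨x, x.2, fun hx => ?_, ?_⟩
  · rw [(QuotientGroup.eq_one_iff x).mpr (mem_subgroupOf.mpr hx), orderOf_one] at hq
    exact h.prime.one_lt.ne hq
  · have h1 := pow_orderOf_eq_one (x : P ⧸ P₀.subgroupOf P)
    rw [hq, ← QuotientGroup.mk_pow, QuotientGroup.eq_one_iff, mem_subgroupOf] at h1
    simpa using h1

/-- As `P / P₀` is abelian, the elements with this property form a normal subgroup of `G`. By
Cauchy's theorem it is larger than `P₀`, so it is all of `P`. -/
theorem pow_prime_mem [Finite G] (h : IsCyclicByChief p k P P₀) {x : G} (hx : x ∈ P) : x ^ p ∈ P₀ := by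
  have := h.normal
  have := h.normal₀
  let K : Subgroup G :=
    { carrier := {x | x ∈ P ∧ x ^ p ∈ P₀}
      one_mem' := ⟨one_mem _, by rw [one_pow]; exact one_mem _⟩
      inv_mem' := fun hx => ⟨inv_mem hx.1, by rw [inv_pow]; exact inv_mem hx.2⟩
      mul_mem' := by
        rintro x y ⟨hx, hx'⟩ ⟨hy, hy'⟩
        refine ⟨mul_mem hx hy, ?_⟩
        rw [← QuotientGroup.eq_one_iff] at hx' hy' ⊢
        have hc : Commute (x : G ⧸ P₀) y := by
          have h1 := (QuotientGroup.eq_one_iff (N := P₀) _).mpr (h.commutatorElement_mem hx hy)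
          rw [← QuotientGroup.mk'_apply, map_commutatorElement,
            commutatorElement_eq_one_iff_commute] at h1
          exact h1
        rw [QuotientGroup.mk_pow] at hx' hy' ⊢
        rw [QuotientGroup.mk_mul, hc.mul_pow, hx', hy', one_mul] }
  have hK : K.Normal := ⟨fun x hx g => ⟨h.normal.conj_mem x hx.1 g, by
    rw [conj_pow]; exact h.normal₀.conj_mem _ hx.2 g⟩⟩
  rcases h.chief K hK (fun x hx => ⟨h.le hx, pow_mem hx p⟩) fun x hx => hx.1 with h1 | h1
  · obtain ⟨x, hxP, hx0, hxp⟩ := h.exists_pow_mem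
    exact absurd (h1 ▸ (⟨hxP, hxp⟩ : x ∈ K)) hx0
  · exact (h1.symm ▸ hx : x ∈ K).2

/-- The centralizer of `P₀` in `P` is `P₀` or `P`. In the first case `P / P₀`, of exponent dividing
`p` and order at least `p ^ 2`, embeds in `Aut(P₀)`, which is cyclic because `p` is odd. -/
theorem base_le_centralizer [Finite G] (h : IsCyclicByChief p k P P₀) :
    P₀ ≤ centralizer (P : Set G) := by
  have := h.normal
  have := h.normal₀
  have := h.isCyclic
  have : Fact p.Prime := ⟨h.prime⟩
  rw [le_centralizer_iff]
  rcases h.chief (P ⊓ centralizer (P₀ : Set G)) inferInstance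
    (le_inf h.le (le_centralizer P₀)) inf_le_left with h1 | h1
  · exfalso
    let f : P →* MulAut P₀ := MulAut.conjNormal.comp P.subtype
    have hker : f.ker = P₀.subgroupOf P := by
      ext x
      rw [mem_subgroupOf, MonoidHom.mem_ker]
      conv_rhs => rw [← h1]
      rw [mem_inf, mem_centralizer_iff]
      simp only [MulEquiv.ext_iff, Subtype.ext_iff, SetLike.coe_mem, true_and]
      refine ⟨fun hf y hy => ?_, fun hf y => ?_⟩
      · have := hf ⟨y, hy⟩
        simp only [f, MonoidHom.comp_apply, MulAut.conjNormal_apply] at this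
        exact (mul_inv_eq_iff_eq_mul.mp this).symm
      · simp only [f, MonoidHom.comp_apply, MulAut.conjNormal_apply]
        exact mul_inv_eq_iff_eq_mul.mpr (hf y y.2).symm
    obtain ⟨m, hm⟩ := IsPGroup.iff_card.mp (h.isPGroup.to_le h.le)
    have hcyc : IsCyclic (ZMod (Nat.card P₀))ˣ := by
      rw [hm]; exact ZMod.isCyclic_units_of_prime_pow p h.prime h.ne_two m
    have hcyc' : IsCyclic (MulAut P₀) :=
      isCyclic_of_injective (IsCyclic.mulAutMulEquiv P₀).toMonoidHom
        (IsCyclic.mulAutMulEquiv P₀).injective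
    have hcard : Nat.card f.range = p ^ k := by
      rw [← index_ker, hker]; exact h.relIndex
    have hdvd : Monoid.exponent f.range ∣ p := by
      refine Monoid.exponent_dvd_of_forall_pow_eq_one ?_
      rintro ⟨-, x, rfl⟩
      have : x ^ p ∈ f.ker := by
        rw [hker, mem_subgroupOf]; exact h.pow_prime_mem x.2
      exact Subtype.ext (by simpa using this)
    rw [IsCyclic.exponent_eq_card, hcard] at hdvd
    have h2 := Nat.le_of_dvd h.prime.pos hdvd
    have h3 := Nat.pow_lt_pow_right h.prime.one_lt h.two_le
    have h4 := Nat.pow_le_pow_right h.prime.pos h.two_le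
    nlinarith [h.prime.two_le]
  · exact inf_eq_left.mp h1

theorem commute [Finite G] (h : IsCyclicByChief p k P P₀) {x z : G} (hx : x ∈ P) (hz : z ∈ P₀) :
    Commute z x :=
  (mem_centralizer_iff.mp (h.base_le_centralizer hz) x hx).symm

/-- Conjugation by `x` fixes the central element `y ^ p` but multiplies `y` by the central element
`⁅x, y⁆`. -/
theorem commutatorElement_pow [Finite G] (h : IsCyclicByChief p k P P₀) {x y : G} (hx : x ∈ P)
    (hy : y ∈ P) : ⁅x, y⁆ ^ p = 1 := by
  have hc := h.commutatorElement_mem hx hy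
  have h1 : x * y * x⁻¹ = ⁅x, y⁆ * y := by rw [commutatorElement_def]; group
  have h2 : (x * y * x⁻¹) ^ p = y ^ p := by
    rw [conj_pow, (h.commute hx (h.pow_prime_mem hy)).symm.eq, mul_inv_cancel_right]
  rw [h1, (h.commute hy hc).mul_pow] at h2
  exact mul_eq_right.mp h2

theorem mul_pow_prime [Finite G] (h : IsCyclicByChief p k P P₀) {x y : G} (hx : x ∈ P) (hy : y ∈ P) :
    (x * y) ^ p = x ^ p * y ^ p := by
  have hc := h.commutatorElement_mem hy hx
  have hdvd : p ∣ p.choose 2 :=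
    h.prime.dvd_choose_self two_ne_zero (lt_of_le_of_ne h.prime.two_le h.ne_two.symm)
  obtain ⟨m, hm⟩ := hdvd
  rw [mul_pow_of_commute_commutatorElement (h.commute hx hc) (h.commute hy hc), hm, pow_mul,
    h.commutatorElement_pow hy hx, one_pow, mul_one]

/-- The power map `x ↦ x ^ p` of `P`, with values in `P₀`. -/
def powHom [Finite G] (h : IsCyclicByChief p k P P₀) : P →* P₀ where
  toFun x := ⟨(x : G) ^ p, h.pow_prime_mem x.2⟩
  map_one' := Subtype.ext (one_pow p)
  map_mul' x y := Subtype.ext (h.mul_pow_prime x.2 y.2)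

/-- The subgroup of the elements `x` of `P` with `x ^ p = 1`. -/
def torsion [Finite G] (h : IsCyclicByChief p k P P₀) : Subgroup G :=
  h.powHom.ker.map P.subtype

theorem mem_torsion [Finite G] (h : IsCyclicByChief p k P P₀) {x : G} :
    x ∈ h.torsion ↔ x ∈ P ∧ x ^ p = 1 := by
  simp only [torsion, mem_map, MonoidHom.mem_ker, powHom, MonoidHom.coe_mk, OneHom.coe_mk]
  constructor
  · rintro ⟨x, hx, rfl⟩
    exact ⟨x.2, congrArg Subtype.val hx⟩
  · rintro ⟨hx, hx1⟩
    exact ⟨⟨x, hx⟩, Subtype.ext hx1, rfl⟩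

theorem torsion_eq_omega1 [Finite G] (h : IsCyclicByChief p k P P₀) :
    Omega1 p P = h.torsion := by
  have : {x : G | x ∈ P ∧ x ^ p = 1} = h.torsion := by
    ext x; exact h.mem_torsion.symm
  rw [Omega1, this, closure_eq]

theorem torsion_le [Finite G] (h : IsCyclicByChief p k P P₀) : h.torsion ≤ P :=
  fun _ hx => (h.mem_torsion.mp hx).1

theorem card_torsion_inf_le [Finite G] (h : IsCyclicByChief p k P P₀) :
    Nat.card (h.torsion ⊓ P₀ : Subgroup G) ≤ p :=
  have := h.isCyclic
  card_le_of_le_isCyclic h.prime.pos inf_le_right fun _ hx => (h.mem_torsion.mp hx.1).2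

/-- Otherwise the kernel of the power map lies in the cyclic group `P₀` and has order at most `p`.
As the image also lies in `P₀`, this gives `|P| ≤ p |P₀|`, against index `p ^ k`. -/
theorem torsion_sup [Finite G] (h : IsCyclicByChief p k P P₀) : h.torsion ⊔ P₀ = P := by
  have := h.normal₀
  have hn : h.torsion.Normal := ⟨fun x hx g => by
    rw [mem_torsion] at hx ⊢
    exact ⟨h.normal.conj_mem x hx.1 g, by rw [conj_pow, hx.2]; group⟩⟩
  rcases h.chief (h.torsion ⊔ P₀) inferInstance le_sup_right (sup_le h.torsion_le h.le)
    with h1 | h1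
  · exfalso
    have hle : h.torsion ≤ P₀ := sup_eq_right.mp h1
    have hcard : Nat.card h.torsion ≤ p := by
      have := h.card_torsion_inf_le
      rwa [inf_eq_left.mpr hle] at this
    have hcard' : Nat.card h.torsion = Nat.card h.powHom.ker :=
      Nat.card_congr (h.powHom.ker.equivMapOfInjective _ P.subtype_injective).toEquiv.symm
    have hP : Nat.card h.powHom.ker * Nat.card h.powHom.range = Nat.card P := by
      rw [← index_ker, card_mul_index]
    have hrange : Nat.card h.powHom.range ≤ Nat.card P₀ :=
      Nat.card_le_card_of_injective _ h.powHom.range.subtype_injective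
    have hP' : Nat.card P₀ * p ^ k = Nat.card P := by
      rw [← h.relIndex, ← relIndex_bot_left, ← relIndex_bot_left]
      exact relIndex_mul_relIndex ⊥ P₀ P bot_le h.le
    have h4 := Nat.pow_le_pow_right h.prime.pos h.two_le
    have hpos : 0 < Nat.card P₀ := Nat.card_pos
    have h5 : Nat.card P ≤ p * Nat.card P₀ := by
      rw [← hP, ← hcard']; exact Nat.mul_le_mul hcard hrange
    have h6 : p < p ^ k := lt_of_lt_of_le (by nlinarith [h.prime.two_le]) h4
    nlinarith
  · exact h1

end IsCyclicByChief

/-! ### The abelian and nonabelian cases -/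

namespace IsCyclicByChief

variable {G : Type*} [Group G] {p k : ℕ} {P P₀ : Subgroup G}

theorem exists_complement [Finite G] (h : IsCyclicByChief p k P P₀)
    (hab : ∀ x ∈ P, ∀ y ∈ P, x * y = y * x) :
    ∃ T ≤ h.torsion, T ⊓ P₀ = ⊥ ∧ T ⊔ P₀ = P := by
  have : Fact p.Prime := ⟨h.prime⟩
  by_cases hbot : h.torsion ⊓ P₀ = ⊥
  · exact ⟨h.torsion, le_rfl, hbot, h.torsion_sup⟩
  obtain ⟨z, hz, hz1⟩ := (bot_or_exists_ne_one _).resolve_left hbot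
  have hzp : z ^ p = 1 := (h.mem_torsion.mp hz.1).2
  have hzz : zpowers z = h.torsion ⊓ P₀ := by
    refine eq_of_le_of_card_ge (zpowers_le.mpr hz) ?_
    rw [Nat.card_zpowers, orderOf_eq_prime_iff.mpr ⟨hzp, hz1⟩]
    exact h.card_torsion_inf_le
  have hcomm : commutator h.torsion ≤ ⊥ := by
    refine (le_bot_iff.mpr ?_)
    rw [commutator_eq_bot_iff_center_eq_top, eq_top_iff]
    exact fun a _ => mem_center_iff.mpr fun b =>
      Subtype.ext (hab b (h.torsion_le b.2) a (h.torsion_le a.2))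
  -- `torsion ∩ P₀` has order `p` and is generated by `z`, so a maximal subgroup of `torsion`
  -- avoiding `z` is the complement.
  obtain ⟨M, -, hzM, htop, -⟩ := exists_le_isCoatom_notMem (E := h.torsion) h.prime
    (fun x => Subtype.ext (h.mem_torsion.mp x.2).2) hcomm (x := ⟨z, hz.1⟩)
    (fun h1 => hz1 (congrArg Subtype.val (mem_bot.mp h1)))
  have hMz : M.map h.torsion.subtype ⊔ zpowers z = h.torsion := by
    have := congrArg (Subgroup.map h.torsion.subtype) htop
    rwa [Subgroup.map_sup, MonoidHom.map_zpowers, ← MonoidHom.range_eq_map, range_subtype] at this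
  have hzM' : z ∉ M.map h.torsion.subtype := by
    rintro ⟨y, hy, hyz⟩
    exact hzM ((Subtype.ext hyz : y = ⟨z, hz.1⟩) ▸ hy)
  refine ⟨M.map h.torsion.subtype, map_subtype_le M, ?_, ?_⟩
  · rw [eq_bot_iff]
    rintro w ⟨hwM, hw0⟩
    by_contra hw1
    have hwz : w ∈ zpowers z := hzz ▸ ⟨map_subtype_le M hwM, hw0⟩
    obtain ⟨i, rfl⟩ := mem_zpowers_iff.mp hwz
    exact hzM' (zpowers_le.mpr hwM (mem_zpowers_zpow_of_pow_eq_one h.prime hzp hw1))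
  · conv_rhs => rw [← h.torsion_sup, ← hMz, sup_assoc, sup_eq_right.mpr (zpowers_le.mpr hz.2)]

theorem exists_isInternalDirectProduct [Finite G] (h : IsCyclicByChief p k P P₀)
    (hab : ∀ x ∈ P, ∀ y ∈ P, x * y = y * x) :
    ∃ T : Subgroup G, IsInternalDirectProduct P P₀ T ∧
      Nonempty (T ≃* Multiplicative (Fin k → ZMod p)) := by
  have := h.normal₀
  obtain ⟨T, hT, hinf, hsup⟩ := h.exists_complement hab
  have hTP := hT.trans h.torsion_le
  refine ⟨T, ⟨sup_comm T P₀ ▸ hsup, inf_comm T P₀ ▸ hinf,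
    fun a ha b hb => hab a (h.le ha) b (hTP hb)⟩, ?_⟩
  refine nonempty_mulEquiv_pi_zmod h.prime
    (fun x y => Subtype.ext (hab x (hTP x.2) y (hTP y.2)))
    (fun x => Subtype.ext (h.mem_torsion.mp (hT x.2)).2) ?_
  rw [← h.relIndex, ← hsup, relIndex_sup_right, ← inf_relIndex_right, inf_comm, hinf,
    relIndex_bot_left]

theorem inf_centralizer_eq [Finite G] (h : IsCyclicByChief p k P P₀)
    (hab : ¬ ∀ x ∈ P, ∀ y ∈ P, x * y = y * x) : P ⊓ centralizer (P : Set G) = P₀ := by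
  have := h.normal
  refine (h.chief (P ⊓ centralizer (P : Set G)) inferInstance
    (le_inf h.le h.base_le_centralizer) inf_le_left).resolve_right fun h1 => hab fun x hx y hy => ?_
  rw [← h1] at hy
  exact mem_centralizer_iff.mp hy.2 x hx

theorem map_center_eq [Finite G] (h : IsCyclicByChief p k P P₀)
    (hab : ¬ ∀ x ∈ P, ∀ y ∈ P, x * y = y * x) : (center P).map P.subtype = P₀ := by
  rw [← h.inf_centralizer_eq hab]
  ext x
  simp only [mem_map, mem_inf, mem_centralizer_iff, mem_center_iff]
  constructor
  · rintro ⟨y, hy, rfl⟩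
    exact ⟨y.2, fun g hg => congrArg Subtype.val (hy ⟨g, hg⟩)⟩
  · rintro ⟨hx, hx'⟩
    exact ⟨⟨x, hx⟩, fun g => Subtype.ext (hx' g g.2), rfl⟩

theorem isCentralProduct [Finite G] (h : IsCyclicByChief p k P P₀) :
    IsCentralProduct P h.torsion P₀ :=
  ⟨h.torsion_sup, fun _ ha _ hb => (h.commute (h.torsion_le ha) hb).symm.eq,
    inf_le_right.trans h.base_le_centralizer⟩

theorem map_center_torsion [Finite G] (h : IsCyclicByChief p k P P₀)
    (hab : ¬ ∀ x ∈ P, ∀ y ∈ P, x * y = y * x) :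
    (center h.torsion).map h.torsion.subtype = h.torsion ⊓ P₀ := by
  ext x
  constructor
  · rintro ⟨y, hy, rfl⟩
    refine ⟨y.2, ?_⟩
    refine (h.inf_centralizer_eq hab).le ⟨h.torsion_le y.2, ?_⟩
    have hle : P ≤ centralizer {(y : G)} := by
      conv_lhs => rw [← h.torsion_sup]
      refine sup_le (fun g hg => ?_) fun g hg => ?_
      · rw [mem_centralizer_singleton_iff]
        exact congrArg Subtype.val (mem_center_iff.mp hy ⟨g, hg⟩)
      · rw [mem_centralizer_singleton_iff]
        exact (h.commute (h.torsion_le y.2) hg).eq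
    exact mem_centralizer_iff.mpr fun g hg => mem_centralizer_singleton_iff.mp (hle hg)
  · rintro ⟨hx, hx'⟩
    exact ⟨⟨x, hx⟩, mem_center_iff.mpr fun g =>
      Subtype.ext (h.commute (h.torsion_le g.2) hx').symm.eq, rfl⟩

/-- The centre is `torsion ∩ P₀`, of order at most `p`, and contains the derived subgroup. The
latter is nontrivial: an abelian `torsion` would lie in `P₀`, forcing `P = P₀`. So both have order
`p`. -/
theorem isExtraspecial_torsion [Finite G] (h : IsCyclicByChief p k P P₀)
    (hab : ¬ ∀ x ∈ P, ∀ y ∈ P, x * y = y * x) : IsExtraspecial p h.torsion := by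
  have : Fact p.Prime := ⟨h.prime⟩
  have hexp : ∀ x : h.torsion, x ^ p = 1 := fun x => Subtype.ext (h.mem_torsion.mp x.2).2
  have hpg : IsPGroup p h.torsion := h.isPGroup.to_le h.torsion_le
  have hZ := h.map_center_torsion hab
  have hcard : Nat.card (center h.torsion) ≤ p := by
    rw [Nat.card_congr ((center h.torsion).equivMapOfInjective _
      h.torsion.subtype_injective).toEquiv, hZ]
    exact h.card_torsion_inf_le
  have hle : commutator h.torsion ≤ center h.torsion := by
    rw [← map_le_map_iff_of_injective h.torsion.subtype_injective, hZ, map_subtype_commutator]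
    exact le_inf (commutator_le_self _)
      ((commutator_mono h.torsion_le h.torsion_le).trans h.commutator_le)
  have hne : commutator h.torsion ≠ ⊥ := by
    intro hbot
    refine hab ?_
    have htop := (commutator_eq_bot_iff_center_eq_top _).mp hbot
    rw [htop, ← MonoidHom.range_eq_map, range_subtype] at hZ
    have hP : P = P₀ := by
      conv_lhs => rw [← h.torsion_sup]
      exact sup_eq_right.mpr (inf_eq_left.mp hZ.symm)
    exact absurd hP.symm h.ne
  have hcard' : p ≤ Nat.card (commutator h.torsion) := by
    have : Nontrivial (commutator h.torsion) := (nontrivial_iff_ne_bot _).mpr hne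
    obtain ⟨n, hn, hn'⟩ := (hpg.to_subgroup (commutator h.torsion)).nontrivial_iff_card.mp this
    rw [hn']
    exact Nat.le_self_pow hn.ne' p
  have heq : commutator h.torsion = center h.torsion :=
    eq_of_le_of_card_ge hle (hcard.trans hcard')
  exact ⟨inferInstance, hpg, le_antisymm hcard (heq ▸ hcard'), heq,
    (frattini_eq_commutator_of_exponent h.prime hexp).trans heq⟩

theorem directProduct_or_centralProduct [Finite G] (h : IsCyclicByChief p k P P₀) :
    (∃ T : Subgroup G, IsInternalDirectProduct P P₀ T ∧
      Nonempty (T ≃* Multiplicative (Fin k → ZMod p))) ∨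
    (IsCentralProduct P (Omega1 p P) P₀ ∧ P₀ = (center P).map P.subtype ∧
      (Omega1 p P : Set G) = {x : G | x ∈ P ∧ x ^ p = 1} ∧ IsExtraspecial p (Omega1 p P)) := by
  by_cases hab : ∀ x ∈ P, ∀ y ∈ P, x * y = y * x
  · exact Or.inl (h.exists_isInternalDirectProduct hab)
  · rw [h.torsion_eq_omega1]
    exact Or.inr ⟨h.isCentralProduct, (h.map_center_eq hab).symm,
      Set.ext fun x => h.mem_torsion, h.isExtraspecial_torsion hab⟩

end IsCyclicByChief

/-! ### Two involutions acting irreducibly, and the parity of `k` -/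

theorem exists_ne_one_zpow_eigenvector {Q : Type*} [CommGroup Q] [Nontrivial Q] (α : Q →* Q)
    (hα : ∀ x, α (α x) = x) : ∃ v : Q, v ≠ 1 ∧ ∃ ε : ℤ, α v = v ^ ε := by
  obtain ⟨x, hx⟩ := exists_ne (1 : Q)
  by_cases h : x * α x = 1
  · exact ⟨x, hx, -1, by rw [zpow_neg_one]; exact (inv_eq_of_mul_eq_one_right h).symm⟩
  · exact ⟨x * α x, h, 1, by rw [map_mul, hα, zpow_one, mul_comm]⟩

/-- A finite abelian group on which two involutory endomorphisms act irreducibly is cyclic or has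
square order. -/
theorem isSquare_card_or_isCyclic {Q : Type*} [CommGroup Q] [Finite Q] [Nontrivial Q]
    (α β : Q →* Q) (hα : ∀ x, α (α x) = x) (hβ : ∀ x, β (β x) = x)
    (hirr : ∀ K : Subgroup Q, (∀ x ∈ K, α x ∈ K) → (∀ x ∈ K, β x ∈ K) → K = ⊥ ∨ K = ⊤) :
    IsSquare (Nat.card Q) ∨ IsCyclic Q := by
  obtain ⟨v, hv, ε, hε⟩ := exists_ne_one_zpow_eigenvector α hα
  -- Additively `σ = αβ + βα`. It commutes with `α`, so `α` acts as the scalar `ε` on the span `W`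
  -- of the `σ`-orbit of `v`.
  let σ : Q →* Q := α.comp β * β.comp α
  have hσ : ∀ x, σ x = α (β x) * β (α x) := fun _ => rfl
  have hασ : ∀ x, α (σ x) = σ (α x) := fun x => by
    rw [hσ, hσ, map_mul, hα, hα, mul_comm]
  let W : Subgroup Q := closure (Set.range fun n : ℕ => σ^[n] v)
  have hvW : v ∈ W := subset_closure ⟨0, rfl⟩
  have hWσ : ∀ w ∈ W, σ w ∈ W := by
    have : W ≤ W.comap σ := by
      rw [closure_le]
      rintro - ⟨n, rfl⟩
      exact subset_closure ⟨n + 1, Function.iterate_succ_apply' σ n v⟩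
    exact this
  have hWα : ∀ w ∈ W, α w = w ^ ε := by
    have : W ≤ α.eqLocus (zpowGroupHom ε) := by
      rw [closure_le]
      rintro - ⟨n, rfl⟩
      change α (σ^[n] v) = (σ^[n] v) ^ ε
      induction n with
      | zero => exact hε
      | succ n ih => rw [Function.iterate_succ_apply', hασ, ih, map_zpow]
    exact this
  have hU : W ⊔ W.map β = ⊤ := by
    refine (hirr (W ⊔ W.map β) (fun x hx => ?_) fun x hx => ?_).resolve_left fun h =>
      hv (mem_bot.mp (h ▸ mem_sup_left hvW))
    · obtain ⟨w, hw, -, ⟨w', hw', rfl⟩, rfl⟩ := mem_sup.mp hx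
      -- Additively `αβ = σ - βα`, which keeps `W + βW` stable under `α`.
      have h1 : α (β w') = σ w' * β (w' ^ (-ε)) := by
        rw [hσ, hWα w' hw', mul_assoc, ← map_mul, ← zpow_add, add_neg_cancel, zpow_zero, map_one,
          mul_one]
      rw [map_mul, hWα w hw, h1, ← mul_assoc]
      exact mul_mem_sup (mul_mem (zpow_mem hw ε) (hWσ w' hw'))
        (mem_map_of_mem β (zpow_mem hw' _))
    · obtain ⟨w, hw, -, ⟨w', hw', rfl⟩, rfl⟩ := mem_sup.mp hx
      rw [map_mul, hβ, mul_comm]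
      exact mul_mem_sup hw' (mem_map_of_mem β hw)
  rcases hirr (W ⊓ W.map β) (fun x hx => hWα x hx.1 ▸ zpow_mem hx ε) (by
    rintro - ⟨hx, y, hy, rfl⟩
    exact ⟨(hβ y).symm ▸ hy, mem_map_of_mem β hx⟩) with h | h
  · left
    have hc : IsComplement' W (W.map β) :=
      isComplement'_of_disjoint_and_mul_eq_univ (disjoint_iff.mpr h) (by
        rw [← mul_normal, hU, coe_top])
    refine ⟨Nat.card W, ?_⟩
    rw [← hc.card_mul_card]
    congr 1
    exact Nat.card_congr (W.equivMapOfInjective β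
      (Function.LeftInverse.injective hβ)).toEquiv.symm
  · right
    -- Now `α` is a scalar on all of `Q`, so the span of an eigenvector of `β` is invariant under
    -- both maps.
    have hW : W = ⊤ := top_le_iff.mp (h ▸ inf_le_left)
    obtain ⟨u, hu, δ, hδ⟩ := exists_ne_one_zpow_eigenvector β hβ
    rw [isCyclic_iff_exists_zpowers_eq_top]
    refine ⟨u, (hirr (zpowers u) (fun x hx => ?_) fun x hx => ?_).resolve_left fun h1 =>
      hu (zpowers_eq_bot.mp h1)⟩
    · exact hWα x (hW ▸ mem_top x) ▸ zpow_mem hx ε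
    · obtain ⟨i, rfl⟩ := mem_zpowers_iff.mp hx
      rw [map_zpow, hδ]
      exact zpow_mem (zpow_mem (mem_zpowers u) _) _

namespace IsCyclicByChief

variable {G : Type*} [Group G] {p k : ℕ} {P P₀ : Subgroup G}

/-- `P` normalizes every subgroup between `P₀` and `P`, since `P / P₀` is abelian; only `a` and `b`
need checking. -/
theorem normal_of_conj_mem [Finite G] (h : IsCyclicByChief p k P P₀) {a b : G}
    (hgen : P ⊔ closure {a, b} = ⊤) {K : Subgroup G} (hle : P₀ ≤ K) (hKP : K ≤ P)
    (ha : ∀ x ∈ K, a * x * a⁻¹ ∈ K) (hb : ∀ x ∈ K, b * x * b⁻¹ ∈ K) : K.Normal := by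
  have hmem : ∀ g : G, (∀ x ∈ K, g * x * g⁻¹ ∈ K) → g ∈ normalizer (K : Set G) := by
    intro g hg
    have h1 : K.map (MulAut.conj g).toMonoidHom = K := by
      refine eq_of_le_of_card_ge (map_le_iff_le_comap.mpr hg) ?_
      rw [Nat.card_congr (K.equivMapOfInjective (MulAut.conj g).toMonoidHom
        (MulAut.conj g).injective).toEquiv]
    rw [mem_normalizer_iff]
    refine fun x => ⟨hg x, fun hx => ?_⟩
    rw [← SetLike.mem_coe, SetLike.mem_coe, ← h1] at hx
    obtain ⟨y, hy, hyx⟩ := hx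
    exact (MulAut.conj g).injective hyx ▸ hy
  rw [← normalizer_eq_top_iff, eq_top_iff, ← hgen]
  refine sup_le (fun g hg => hmem g fun x hx => ?_) ((closure_le _).mpr ?_)
  · have : g * x * g⁻¹ = ⁅g, x⁆ * x := by rw [commutatorElement_def]; group
    rw [this]
    exact mul_mem (hle (h.commutatorElement_mem hg (hKP hx))) hx
  · rintro g (rfl | rfl)
    · exact hmem _ ha
    · exact hmem _ hb

theorem even [Finite G] (h : IsCyclicByChief p k P P₀) {a b : G} (ha : a ^ 2 = 1) (hb : b ^ 2 = 1)
    (hgen : P ⊔ closure {a, b} = ⊤) : Even k := by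
  have := h.normal
  have := h.normal₀
  let π := QuotientGroup.mk' P₀
  have hπ : Function.Surjective π := QuotientGroup.mk'_surjective P₀
  let Q := P.map π
  have hQn : Q.Normal := h.normal.map π hπ
  have hQP : Q.comap π = P := by
    rw [comap_map_eq, QuotientGroup.ker_mk', sup_eq_left.mpr h.le]
  let _ : CommGroup Q :=
    { (inferInstance : Group Q) with
      mul_comm := by
        rintro ⟨-, x, hx, rfl⟩ ⟨-, y, hy, rfl⟩
        refine Subtype.ext ?_
        have h1 := (QuotientGroup.eq_one_iff (N := P₀) _).mpr (h.commutatorElement_mem hx hy)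
        rw [← QuotientGroup.mk'_apply, map_commutatorElement,
          commutatorElement_eq_one_iff_mul_comm] at h1
        exact h1 }
  have hcard : Nat.card Q = p ^ k := by
    have h1 := relIndex_comap ⊥ π P
    rw [MonoidHom.comap_bot, QuotientGroup.ker_mk', relIndex_bot_left, h.relIndex] at h1
    exact h1.symm
  have hpow : ∀ x : Q, x ^ p = 1 := by
    rintro ⟨-, x, hx, rfl⟩
    exact Subtype.ext ((QuotientGroup.eq_one_iff (N := P₀) _).mpr (h.pow_prime_mem hx))
  have hpk : p < p ^ k := lt_self_pow₀ h.prime.one_lt (by have := h.two_le; omega)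
  have hnt : Nontrivial Q := Finite.one_lt_card_iff_nontrivial.mp
    (hcard ▸ h.prime.one_lt.trans hpk)
  have hinv : ∀ c : G, c ^ 2 = 1 → ∀ x : Q,
      MulAut.conjNormal (π c) (MulAut.conjNormal (π c) x) = x := by
    intro c hc x
    rw [← MulAut.mul_apply, ← map_mul, ← map_mul, ← pow_two, hc, map_one, map_one, MulAut.one_apply]
  let α : Q →* Q := (MulAut.conjNormal (π a)).toMonoidHom
  let β : Q →* Q := (MulAut.conjNormal (π b)).toMonoidHom
  have hirr : ∀ K : Subgroup Q, (∀ x ∈ K, α x ∈ K) → (∀ x ∈ K, β x ∈ K) → K = ⊥ ∨ K = ⊤ := by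
    intro K hKa hKb
    let K' := (K.map Q.subtype).comap π
    have hle : P₀ ≤ K' := by
      rw [← QuotientGroup.ker_mk' P₀]; exact π.ker_le_comap _
    have hKP : K' ≤ P := hQP ▸ comap_mono (map_subtype_le K)
    have hconj : ∀ c : G, (∀ x ∈ K, MulAut.conjNormal (π c) x ∈ K) →
        ∀ x ∈ K', c * x * c⁻¹ ∈ K' := by
      rintro c hc x ⟨y, hy, hyx⟩
      refine ⟨_, hc y hy, ?_⟩
      rw [map_mul, map_mul, map_inv, ← hyx]
      exact MulAut.conjNormal_apply (π c) y
    have hinj : Function.Injective fun L : Subgroup Q => (L.map Q.subtype).comap π :=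
      (comap_injective hπ).comp (map_injective Q.subtype_injective)
    refine (h.chief K' (h.normal_of_conj_mem hgen hle hKP (hconj a hKa) (hconj b hKb)) hle hKP).imp
      (fun h1 => hinj (h1.trans ?_)) fun h1 => hinj (h1.trans ?_)
    · simp only [Subgroup.map_bot, MonoidHom.comap_bot]
      exact (QuotientGroup.ker_mk' P₀).symm
    · simp only [← MonoidHom.range_eq_map, range_subtype]
      exact hQP.symm
  rcases isSquare_card_or_isCyclic α β (hinv a ha) (hinv b hb) hirr with h1 | h1
  · obtain ⟨m, hm⟩ := h1
    rw [hcard] at hm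
    obtain ⟨j, -, rfl⟩ := (Nat.dvd_prime_pow h.prime).mp ⟨m, hm⟩
    rw [← pow_add] at hm
    exact ⟨j, Nat.pow_right_injective h.prime.two_le hm⟩
  · exfalso
    have h2 := Monoid.exponent_dvd_of_forall_pow_eq_one hpow
    rw [IsCyclic.exponent_eq_card, hcard] at h2
    exact absurd (Nat.le_of_dvd h.prime.pos h2) (not_le.mpr hpk)

end IsCyclicByChief

/-! ### From a maximal dihedral subgroup to a chief factor -/

theorem mem_of_pow_eq_one_of_not_dvd_index {G : Type*} [Group G] {p : ℕ} (hp : p.Prime)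
    {P : Subgroup G} [P.Normal] (hP : ¬ p ∣ P.index) {x : G} (hx : x ^ p = 1) : x ∈ P := by
  rw [← QuotientGroup.eq_one_iff, ← orderOf_eq_one_iff]
  rcases (Nat.dvd_prime hp).mp (orderOf_dvd_of_pow_eq_one
    (show (x : G ⧸ P) ^ p = 1 by rw [← QuotientGroup.mk_pow, hx, QuotientGroup.mk_one])) with h | h
  · exact h
  · exact absurd (h ▸ orderOf_dvd_natCard (x : G ⧸ P)) hP

theorem index_eq_of_isCoatom_of_isPGroup {G : Type*} [Group G] [Finite G] {p k : ℕ}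
    (hp : p.Prime) (hG : IsPGroup p G) {H : Subgroup G} (hH : IsCoatom H) (hk : H.index = p ^ k) :
    k = 1 := by
  have : Fact p.Prime := ⟨hp⟩
  obtain ⟨m, hm⟩ := IsPGroup.iff_card.mp (hG.to_subgroup H)
  have hcard : Nat.card G = p ^ (m + k) := by
    rw [← H.card_mul_index, hm, hk, pow_add]
  have hk0 : k ≠ 0 := by
    rintro rfl
    exact hH.1 (index_eq_one.mp (hk.trans (pow_zero p)))
  obtain ⟨K, hK, hHK⟩ := Sylow.exists_subgroup_card_pow_succ
    (hcard ▸ pow_dvd_pow p (by omega : m + 1 ≤ m + k)) hm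
  have hne : H ≠ K := by
    rintro rfl
    exact absurd (Nat.pow_right_injective hp.two_le (hm.symm.trans hK)) (by omega)
  rw [hH.2 K (lt_of_le_of_ne hHK hne), card_top, hcard] at hK
  have := Nat.pow_right_injective hp.two_le hK
  omega

theorem mem_zpowers_or_sq_eq_one {G : Type*} [Group G] {a b : G} (ha : a ^ 2 = 1)
    (hb : b ^ 2 = 1) {x : G} (hx : x ∈ closure {a, b}) : x ∈ zpowers (a * b) ∨ x ^ 2 = 1 := by
  have ha' : a⁻¹ = a := inv_eq_of_mul_eq_one_left (by rw [← pow_two, ha])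
  have hb' : b⁻¹ = b := inv_eq_of_mul_eq_one_left (by rw [← pow_two, hb])
  have hconj : ∀ i : ℤ, a * (a * b) ^ i * a = (a * b) ^ (-i) := by
    intro i
    have h1 : a * (a * b) * a⁻¹ = (a * b)⁻¹ := by
      rw [mul_inv_rev, ha', hb', ← mul_assoc, ← pow_two, ha, one_mul]
    calc a * (a * b) ^ i * a = a * (a * b) ^ i * a⁻¹ := by rw [ha']
      _ = (a * b) ^ (-i) := by rw [← conj_zpow, h1, inv_zpow']
  have hmul : ∀ i : ℤ, a * (a * b) ^ i = (a * b) ^ (-i) * a := fun i => by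
    rw [← hconj i, mul_assoc _ a a, ← pow_two, ha, mul_one]
  have hmulb : ∀ i : ℤ, b * (a * b) ^ i = (a * b) ^ (-1 - i) * a := fun i => by
    have h1 : b * (a * b) ^ i = a * (a * b) ^ (1 + i) := by
      rw [zpow_add, zpow_one, ← mul_assoc a, ← mul_assoc a a, ← pow_two, ha, one_mul]
    rw [h1, hmul, neg_add, sub_eq_add_neg]
  have hstep : ∀ g ∈ ({a, b} : Set G), ∀ y : G,
      ((∃ i : ℤ, y = (a * b) ^ i) ∨ ∃ i : ℤ, y = (a * b) ^ i * a) →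
      (∃ i : ℤ, g * y = (a * b) ^ i) ∨ ∃ i : ℤ, g * y = (a * b) ^ i * a := by
    rintro g hg y hy
    rcases hg with rfl | rfl <;> rcases hy with ⟨i, rfl⟩ | ⟨i, rfl⟩
    · exact Or.inr ⟨_, hmul i⟩
    · exact Or.inl ⟨_, (mul_assoc _ _ _).symm.trans (hconj i)⟩
    · exact Or.inr ⟨_, hmulb i⟩
    · exact Or.inl ⟨-1 - i, by rw [← mul_assoc, hmulb, mul_assoc, ← pow_two, ha, mul_one]⟩
  have key : (∃ i : ℤ, x = (a * b) ^ i) ∨ ∃ i : ℤ, x = (a * b) ^ i * a := by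
    induction hx using closure_induction_left with
    | one => exact Or.inl ⟨0, (zpow_zero _).symm⟩
    | mul_left g hg y _ ih => exact hstep g hg y ih
    | inv_mul_cancel g hg y _ ih =>
      have hg' : g⁻¹ = g := by rcases hg with rfl | rfl <;> assumption
      exact hg'.symm ▸ hstep g hg y ih
  rcases key with ⟨i, rfl⟩ | ⟨i, rfl⟩
  · exact Or.inl ⟨i, rfl⟩
  · right
    rw [pow_two, mul_assoc, ← mul_assoc a, hconj, zpow_neg, mul_inv_cancel]

/-- The normalizer of `P ∩ H` contains `H` and, as normalizers grow in the nilpotent group `P`, also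
an element of `P` outside `H`. Maximality of `H` does the rest. -/
theorem inf_normal_of_isCoatom {G : Type*} [Group G] [Finite G] {p : ℕ} (hp : p.Prime)
    {P H : Subgroup G} [P.Normal] (hP : IsPGroup p P) (hH : IsCoatom H) (hPH : ¬ P ≤ H) :
    (P ⊓ H).Normal := by
  have : Fact p.Prime := ⟨hp⟩
  have hnil := hP.isNilpotent
  have hlt : H.subgroupOf P < ⊤ := lt_top_iff_ne_top.mpr fun h => hPH (subgroupOf_eq_top.mp h)
  obtain ⟨x, hx, hxH⟩ := SetLike.exists_of_lt
    (Group.normalizerCondition_of_isNilpotent (H.subgroupOf P) hlt)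
  have hHn : H ≤ normalizer ((P ⊓ H : Subgroup G) : Set G) := fun h hh => by
    rw [mem_normalizer_iff]
    intro y
    rw [mem_inf, mem_inf, H.mul_mem_cancel_right (inv_mem hh), H.mul_mem_cancel_left hh]
    exact and_congr_left fun _ => ⟨fun hy => Normal.conj_mem ‹_› y hy h, fun hy => by
      simpa [mul_assoc] using Normal.conj_mem ‹P.Normal› _ hy h⁻¹⟩
  have hxn : (x : G) ∈ normalizer ((P ⊓ H : Subgroup G) : Set G) := by
    rw [mem_normalizer_iff] at hx ⊢
    intro y
    rw [mem_inf, mem_inf]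
    constructor
    · rintro ⟨hy, hyH⟩
      exact ⟨mul_mem (mul_mem x.2 hy) (inv_mem x.2),
        mem_subgroupOf.mp ((hx ⟨y, hy⟩).mp (mem_subgroupOf.mpr hyH))⟩
    · rintro ⟨hy, hyH⟩
      have hyP : y ∈ P := by
        simpa [mul_assoc] using mul_mem (mul_mem (inv_mem x.2) hy) x.2
      exact ⟨hyP, mem_subgroupOf.mp ((hx ⟨y, hyP⟩).mpr (mem_subgroupOf.mpr hyH))⟩
  rw [← normalizer_eq_top_iff]
  exact hH.2 _ (lt_of_le_of_ne hHn fun h => hxH (mem_subgroupOf.mpr (h ▸ hxn)))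

theorem isCyclicByChief_of_involutions {G : Type*} [Group G] [Finite G] {p k : ℕ} (hp : p.Prime)
    (hk : 2 ≤ k) {a b c : G} (ha : a ^ 2 = 1) (hb : b ^ 2 = 1) (hc : c ^ 2 = 1)
    (hgen : closure {a, b, c} = ⊤) (hmax : IsCoatom (closure {a, b}))
    (hindex : (closure {a, b}).index = p ^ k) {P : Subgroup G} [hPn : P.Normal]
    (hP : IsPGroup p P) (hPi : ¬ p ∣ P.index) :
    IsCyclicByChief p k P (P ⊓ (closure {a, b}).normalCore) ∧ P ⊔ closure {a, b} = ⊤ := by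
  set H := closure {a, b} with hH
  have hPH : ¬ P ≤ H := fun h =>
    hPi ((dvd_pow_self p (by omega)).trans (hindex ▸ index_dvd_of_le h))
  have hsup : P ⊔ H = ⊤ := hmax.2 _ (right_lt_sup.mpr hPH)
  have hinf := inf_normal_of_isCoatom hp hP hmax hPH
  have hcore : P ⊓ H.normalCore = P ⊓ H :=
    le_antisymm (inf_le_inf_left P H.normalCore_le)
      (le_inf inf_le_left (normal_le_normalCore.mpr inf_le_right))
  have hp2 : p ≠ 2 := by
    rintro rfl
    have htop : P = ⊤ := by
      rw [eq_top_iff, ← hgen, closure_le]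
      rintro g (rfl | rfl | rfl)
      · exact mem_of_pow_eq_one_of_not_dvd_index hp hPi ha
      · exact mem_of_pow_eq_one_of_not_dvd_index hp hPi hb
      · exact mem_of_pow_eq_one_of_not_dvd_index hp hPi hc
    have hG : IsPGroup 2 G := (htop ▸ hP).of_surjective (⊤ : Subgroup G).subtype
      fun g => ⟨⟨g, mem_top g⟩, rfl⟩
    have := index_eq_of_isCoatom_of_isPGroup hp hG hmax hindex
    omega
  refine ⟨?_, hsup⟩
  rw [hcore]
  refine ⟨hp, hp2, hk, hP, hPn, hinf, inf_le_left, ?_, ?_, fun K hK hle hKP => ?_⟩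
  -- Elements of `H` that are not rotations square to 1, and `P` has odd order.
  · have hle : P ⊓ H ≤ zpowers (a * b) := by
      rintro x ⟨hxP, hxH⟩
      refine (mem_zpowers_or_sq_eq_one ha hb hxH).elim id fun hx2 => ?_
      obtain ⟨n, hn⟩ := hP ⟨x, hxP⟩
      have hxn : x ^ p ^ n = 1 := congrArg Subtype.val hn
      have hco : Nat.Coprime 2 (p ^ n) :=
        ((Nat.coprime_primes Nat.prime_two hp).mpr hp2.symm).pow_right n
      have h1 : orderOf x ∣ 1 := hco ▸ Nat.dvd_gcd (orderOf_dvd_of_pow_eq_one hx2)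
        (orderOf_dvd_of_pow_eq_one hxn)
      rw [orderOf_eq_one_iff.mp (Nat.dvd_one.mp h1)]
      exact one_mem _
    exact isCyclic_of_injective (inclusion hle) (inclusion_injective hle)
  · have h1 := relIndex_mul_index (inf_le_left : P ⊓ H ≤ P)
    have h2 := relIndex_mul_index (inf_le_right : P ⊓ H ≤ H)
    rw [inf_relIndex_right, ← relIndex_sup_right, sup_comm, hsup, relIndex_top_right, hindex,
      ← h1, mul_comm] at h2
    exact (Nat.eq_of_mul_eq_mul_right (Nat.pos_of_ne_zero P.index_ne_zero_of_finite) h2).symm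
  -- If `K` is not inside `H`, then `K H = G`, and Dedekind's law gives `P = K (P ∩ H) = K`.
  · by_cases hKH : K ≤ H
    · exact Or.inl (le_antisymm (le_inf hKP hKH) hle)
    · refine Or.inr (le_antisymm hKP fun x hx => ?_)
      have htop : x ∈ K ⊔ H := (hmax.2 _ (right_lt_sup.mpr hKH)) ▸ mem_top x
      obtain ⟨u, hu, w, hw, rfl⟩ := mem_sup_of_normal_left.mp htop
      exact mul_mem hu (hle ⟨(P.mul_mem_cancel_left (hKP hu)).mp hx, hw⟩)

/-! ### Automorphisms of regular maps -/

namespace CombinatorialMap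

variable {F : Type*} (M : CombinatorialMap F)

theorem exists_aut_apply_eq_of_mem_closure {x : F} {s : Set (Equiv.Perm F)}
    (hs : s ⊆ M.monodromy) {D : Subgroup M.aut}
    (hD : ∀ h ∈ s, ∃ g ∈ D, (g : Equiv.Perm F) x = h x) {h : Equiv.Perm F}
    (hh : h ∈ closure s) : ∃ g ∈ D, (g : Equiv.Perm F) x = h x := by
  have hle : closure s ≤ M.monodromy := (closure_le _).mpr hs
  induction hh using closure_induction with
  | mem h hh => exact hD h hh
  | one => exact ⟨1, one_mem _, rfl⟩
  | mul h₁ h₂ hh₁ _ ih₁ ih₂ =>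
    obtain ⟨g₁, hg₁, h₁x⟩ := ih₁
    obtain ⟨g₂, hg₂, h₂x⟩ := ih₂
    -- The order is reversed: `g₂` commutes with `h₁`, so `g₂ (g₁ x) = g₂ (h₁ x) = h₁ (g₂ x) = h₁
    -- (h₂ x)`.
    refine ⟨g₂ * g₁, mul_mem hg₂ hg₁, ?_⟩
    change (g₂ : Equiv.Perm F) ((g₁ : Equiv.Perm F) x) = h₁ (h₂ x)
    rw [h₁x, M.aut_apply_comm g₂ (hle hh₁), h₂x]
  | inv h hh ih =>
    obtain ⟨g, hg, hx⟩ := ih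
    refine ⟨g⁻¹, inv_mem hg, ?_⟩
    change (g : Equiv.Perm F)⁻¹ x = h⁻¹ x
    rw [Equiv.Perm.inv_eq_iff_eq, M.aut_apply_comm g (inv_mem (hle hh)), hx]
    exact (h.symm_apply_apply x).symm

theorem sq_eq_one_of_apply_eq (hreg : M.IsRegular) {x : F} {g : M.aut} {h : Equiv.Perm F}
    (hh : h ∈ M.monodromy) (hinv : Function.Involutive h) (hg : (g : Equiv.Perm F) x = h x) :
    g ^ 2 = 1 := by
  refine (hreg x x).unique ?_ rfl
  rw [pow_two]
  change (g : Equiv.Perm F) ((g : Equiv.Perm F) x) = x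
  rw [hg, M.aut_apply_comm g hh, hg, hinv]

/-- The automorphism group of a regular map is generated by three involutions, two of which generate
the stabilizer of a given vertex. -/
theorem exists_involutions_generating (hreg : M.IsRegular) (v : M.Vertex) :
    ∃ a b c : M.aut, a ^ 2 = 1 ∧ b ^ 2 = 1 ∧ c ^ 2 = 1 ∧ closure {a, b, c} = ⊤ ∧
      MulAction.stabilizer M.aut v = closure {a, b} := by
  induction v using Quotient.inductionOn' with | _ x
  have ht : M.t ∈ M.monodromy := subset_closure (by simp)
  have hr : M.r ∈ M.monodromy := subset_closure (by simp)
  have hl : M.l ∈ M.monodromy := subset_closure (by simp)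
  -- The generators are the automorphisms that act on the base flag `x` as `t`, `r` and `l` do.
  obtain ⟨a, ha, -⟩ := hreg x (M.t x)
  obtain ⟨b, hb, -⟩ := hreg x (M.r x)
  obtain ⟨c, hc, -⟩ := hreg x (M.l x)
  refine ⟨a, b, c, M.sq_eq_one_of_apply_eq hreg ht M.t_involutive ha,
    M.sq_eq_one_of_apply_eq hreg hr M.r_involutive hb,
    M.sq_eq_one_of_apply_eq hreg hl M.l_involutive hc, ?_, ?_⟩
  · refine eq_top_iff.mpr fun g _ => ?_
    obtain ⟨h, hh, hx⟩ := M.transitive x ((g : Equiv.Perm F) x)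
    obtain ⟨g', hg', hx'⟩ := M.exists_aut_apply_eq_of_mem_closure (x := x)
      (D := closure {a, b, c}) subset_closure (by
        rintro h (rfl | rfl | rfl)
        · exact ⟨a, subset_closure (by simp), ha⟩
        · exact ⟨b, subset_closure (by simp), hb⟩
        · exact ⟨c, subset_closure (by simp), hc⟩) hh
    rwa [(hreg x _).unique (rfl : (g : Equiv.Perm F) x = _) (hx'.trans hx)]
  · have hvertex : ∀ y z : F, M.vertexOf y = M.vertexOf z ↔ ∃ h ∈ M.vertexGroup, h z = y := by
      intro y z
      refine Quotient.eq''.trans ?_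
      exact ⟨fun ⟨h, hh⟩ => ⟨h, h.2, hh⟩, fun ⟨h, hh, hx⟩ => ⟨⟨h, hh⟩, hx⟩⟩
    have hmem : ∀ g : M.aut, g ∈ MulAction.stabilizer M.aut (M.vertexOf x) ↔
        ∃ h ∈ M.vertexGroup, h x = (g : Equiv.Perm F) x := fun g => by
      rw [MulAction.mem_stabilizer_iff, smul_vertexOf, hvertex]
    change MulAction.stabilizer M.aut (M.vertexOf x) = _
    refine le_antisymm (fun g hg => ?_) ((closure_le _).mpr ?_)
    · obtain ⟨h, hh, hx⟩ := (hmem g).mp hg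
      obtain ⟨g', hg', hx'⟩ := M.exists_aut_apply_eq_of_mem_closure (x := x)
        (D := closure {a, b})
        (subset_closure.trans M.vertexGroup_le_monodromy) (by
          rintro h (rfl | rfl)
          · exact ⟨a, subset_closure (by simp), ha⟩
          · exact ⟨b, subset_closure (by simp), hb⟩) hh
      rwa [(hreg x _).unique (rfl : (g : Equiv.Perm F) x = _) (hx'.trans hx)]
    · rintro g (rfl | rfl)
      · exact (hmem _).mpr ⟨M.t, subset_closure (by simp), ha.symm⟩
      · exact (hmem _).mpr ⟨M.r, subset_closure (by simp), hb.symm⟩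

end CombinatorialMap

theorem proposition7p2 {F : Type*} [Finite F] (M : CombinatorialMap F)
    (p k : ℕ) (hp : p.Prime) (hk : 2 ≤ k)
    (hreg : M.IsRegular)
    (hcard : Nat.card M.Vertex = p ^ k)
    (hnormal : M.IsNormalAt p)
    (hprim : MulAction.IsPreprimitive M.aut M.Vertex)
    (P : Sylow p M.aut) (v : M.Vertex)
    (H : Subgroup M.aut) (hH : H = MulAction.stabilizer M.aut v)
    (P₀ : Subgroup M.aut) (hP₀ : P₀ = (P : Subgroup M.aut) ⊓ H.normalCore) :
    Even k ∧
      ((∃ T : Subgroup M.aut,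
          IsInternalDirectProduct (P : Subgroup M.aut) P₀ T ∧
          Nonempty (T ≃* Multiplicative (Fin k → ZMod p))) ∨
        (IsCentralProduct (P : Subgroup M.aut) (Omega1 p (P : Subgroup M.aut)) P₀ ∧
          P₀ = (Subgroup.center P).map (P : Subgroup M.aut).subtype ∧
          (Omega1 p (P : Subgroup M.aut) : Set M.aut) =
            {x : M.aut | x ∈ (P : Subgroup M.aut) ∧ x ^ p = 1} ∧
          IsExtraspecial p (Omega1 p (P : Subgroup M.aut)))) := by
  have : Fact p.Prime := ⟨hp⟩
  have hPn : (P : Subgroup M.aut).Normal := by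
    obtain ⟨P', hP'⟩ := hnormal
    have := Sylow.unique_of_normal P' hP'
    rwa [Subsingleton.elim P P']
  have hcard1 : 1 < Nat.card M.Vertex := hcard ▸ Nat.one_lt_pow (by omega) hp.one_lt
  have hfin : Finite M.Vertex := Nat.finite_of_card_ne_zero (by omega)
  have hnt : Nontrivial M.Vertex := Finite.one_lt_card_iff_nontrivial.mp hcard1
  obtain ⟨a, b, c, ha, hb, hc, hgen, hstab⟩ := M.exists_involutions_generating hreg v
  have hmax := MulAction.IsPreprimitive.isCoatom_stabilizer_of_isPreprimitive M.aut v
  have hindex := MulAction.index_stabilizer_of_transitive M.aut v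
  rw [hcard] at hindex
  rw [hstab] at hmax hindex hH
  obtain ⟨hchief, hsup⟩ := isCyclicByChief_of_involutions hp hk ha hb hc hgen hmax hindex
    P.isPGroup' P.not_dvd_index
  rw [← hH, ← hP₀] at hchief
  exact ⟨hchief.even ha hb hsup, hchief.directProduct_or_centralProduct⟩
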